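/- Let $G$ be a pseudofinite group, that is, a group whose underlying set is infinite and which satisfies every first-order sentence in the language of groups that is true in all finite groups. Suppose that $G$ is an $\mathfrak{M}_c$-group, that is, $G$ satisfies the descending chain condition on centralizers: for every sequence $S_0, S_1, \dots$ of subsets of $G$ with $C_G(S_0) \geq C_G(S_1) \geq \cdots$, the chain is eventually constant. Call a maximal $2$-subgroup of $G$ a Sylow $2$-subgroup, where a $2$-subgroup is a subgroup in which the order of every element is a power of $2$. If at least one Sylow $2$-subgroup of $G$ is finite, then any two Sylow $2$-subgroups of $G$ are conjugate in $G$, and hence every Sylow $2$-subgroup of $G$ is finite. -/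

import Mathlib

open scoped FirstOrder

/-- The function symbols of the language of groups: `*`, `⁻¹`, `1`. -/
inductive GroupFunc : ℕ → Type
  | mul : GroupFunc 2
  | inv : GroupFunc 1
  | one : GroupFunc 0

/-- The first-order language of groups, with symbols for multiplication, inverse and identity. -/
def groupLanguage : FirstOrder.Language where
  Functions := GroupFunc
  Relations := fun _ => Empty

/-- Every group is a structure for the language of groups, the symbols being interpreted by its
own multiplication, inverse and identity. -/
instance groupStructure (G : Type*) [Group G] : groupLanguage.Structure G where
  funMap := fun {_} f =>
    match f with
    | GroupFunc.mul => fun x => x 0 * x 1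
    | GroupFunc.inv => fun x => (x 0)⁻¹
    | GroupFunc.one => fun _ => 1
  RelMap := fun r => r.elim

/-- The theory of finite groups: the set of all first-order sentences in the language of groups
that hold in every finite group. Since every finite group is isomorphic to one whose underlying
type lies in `Type`, it is enough to quantify over those. -/
def finiteGroupTheory : groupLanguage.Theory :=
  {φ | ∀ (F : Type) [Group F] [Finite F], F ⊨ φ}

/-- A pseudofinite group is an infinite model of the theory of finite groups. -/
def IsPseudofiniteGroup (G : Type*) [Group G] : Prop :=
  Infinite G ∧ G ⊨ finiteGroupTheory

/-- The descending chain condition on centralizers: every descending chain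
`C_G(S 0) ≥ C_G(S 1) ≥ ...` of centralizers of subsets of `G` is eventually constant.
Groups with this property are called `𝔐_c`-groups. -/
def IsMcGroup (G : Type*) [Group G] : Prop :=
  ∀ S : ℕ → Set G, Antitone (fun n => Subgroup.centralizer (S n)) →
    ∃ N : ℕ, ∀ n : ℕ, N ≤ n → Subgroup.centralizer (S n) = Subgroup.centralizer (S N)

/-! A 2-subgroup H of a finite group is Sylow as soon as no z outside H normalizes H with z² ∈ H,
because a proper subgroup of a finite 2-group always admits such a z. Once orders are fixed this
test is first-order, so each instance of Sylow conjugacy is a single sentence, `conjugacySentence`,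
and passes to G. A finite Sylow 2-subgroup P of G meets the test, hence every finite 2-subgroup of G
is conjugate into P.

An arbitrary Sylow 2-subgroup Q therefore has finite subgroups of order at most |P| only, which
forces Q to be finite (`IsPGroup.finite_of_bounded_finite_subgroups`). Now Q itself is conjugate
into any other Sylow 2-subgroup, and maximality gives equality. -/

open FirstOrder Language
open scoped Pointwise

/-! ### Sylow conjugacy as first-order sentences -/

namespace GroupFormula

variable {V : Type} {M : Type*} [Group M]

/-- The product of two terms in the language of groups. -/
def mulTerm (s t : groupLanguage.Term V) : groupLanguage.Term V :=
  Functions.apply₂ (L := groupLanguage) GroupFunc.mul s t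

/-- The inverse of a term in the language of groups. -/
def invTerm (t : groupLanguage.Term V) : groupLanguage.Term V :=
  Functions.apply₁ (L := groupLanguage) GroupFunc.inv t

/-- The identity as a term in the language of groups. -/
def oneTerm : groupLanguage.Term V :=
  Constants.term (L := groupLanguage) GroupFunc.one

/-- The powers of a term in the language of groups. -/
def powTerm (t : groupLanguage.Term V) : ℕ → groupLanguage.Term V
  | 0 => oneTerm
  | n + 1 => mulTerm (powTerm t n) t

@[simp]
theorem realize_mulTerm (s t : groupLanguage.Term V) (v : V → M) :
    (mulTerm s t).realize v = s.realize v * t.realize v :=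
  (Term.realize_functions_apply₂ (L := groupLanguage) (f := GroupFunc.mul)).trans rfl

@[simp]
theorem realize_invTerm (t : groupLanguage.Term V) (v : V → M) :
    (invTerm t).realize v = (t.realize v)⁻¹ :=
  (Term.realize_functions_apply₁ (L := groupLanguage) (f := GroupFunc.inv)).trans rfl

@[simp]
theorem realize_oneTerm (v : V → M) : (oneTerm : groupLanguage.Term V).realize v = 1 := rfl

@[simp]
theorem realize_powTerm (t : groupLanguage.Term V) (n : ℕ) (v : V → M) :
    (powTerm t n).realize v = t.realize v ^ n := by
  induction n with
  | zero => simp [powTerm]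
  | succ n ih => simp [powTerm, ih, pow_succ]

variable {n : ℕ}

/-- The formula saying that the value of a term is an entry of a tuple of variables. -/
noncomputable def memRange (t : groupLanguage.Term V) (x : Fin n → V) :
    groupLanguage.Formula V :=
  Formula.iSup fun j => t.equal (Term.var (x j))

@[simp]
theorem realize_memRange (t : groupLanguage.Term V) (x : Fin n → V) (v : V → M) :
    (memRange t x).Realize v ↔ t.realize v ∈ Set.range (v ∘ x) := by
  simp [memRange, eq_comm]

/-- The formula saying that the entries of a tuple of variables form a subgroup all of whose
elements have order dividing `N`. -/
noncomputable def isTorsionSubgroup (N : ℕ) (x : Fin n → V) : groupLanguage.Formula V :=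
  memRange oneTerm x ⊓
    ((Formula.iInf fun i => Formula.iInf fun j =>
      memRange (mulTerm (Term.var (x i)) (Term.var (x j))) x) ⊓
    ((Formula.iInf fun i => memRange (invTerm (Term.var (x i))) x) ⊓
    (Formula.iInf fun i => (powTerm (Term.var (x i)) N).equal oneTerm)))

theorem realize_isTorsionSubgroup (N : ℕ) (x : Fin n → V) (v : V → M) :
    (isTorsionSubgroup N x).Realize v ↔
      ∃ H : Subgroup M, (H : Set M) = Set.range (v ∘ x) ∧ ∀ h ∈ H, h ^ N = 1 := by
  simp only [isTorsionSubgroup, Formula.realize_inf, Formula.realize_iInf, realize_memRange,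
    realize_mulTerm, realize_invTerm, realize_oneTerm, Formula.realize_equal, realize_powTerm,
    Term.realize_var]
  constructor
  · rintro ⟨h1, hm, hi, ht⟩
    refine ⟨{ carrier := Set.range (v ∘ x), one_mem' := h1, mul_mem' := ?_, inv_mem' := ?_ },
      rfl, ?_⟩
    · rintro _ _ ⟨i, rfl⟩ ⟨j, rfl⟩
      exact hm i j
    · rintro _ ⟨i, rfl⟩
      exact hi i
    · rintro _ ⟨i, rfl⟩
      exact ht i
  · rintro ⟨H, hH, ht⟩
    have hx : ∀ i, v (x i) ∈ H := fun i => by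
      rw [← SetLike.mem_coe, hH]
      exact ⟨i, rfl⟩
    rw [← hH]
    exact ⟨H.one_mem, fun i j => H.mul_mem (hx i) (hx j), fun i => H.inv_mem (hx i),
      fun i => ht _ (hx i)⟩

/-- The sentence saying that every `m`-element subgroup of exponent dividing `N'` is conjugate into
every `n`-element subgroup `H` of exponent dividing `N` such that `N(H) / H` has no involution. -/
noncomputable def conjugacySentence (n m N N' : ℕ) : groupLanguage.Sentence :=
  Formula.iAlls (Fin n) <| Formula.iAlls (Fin m) <|
    (isTorsionSubgroup N fun i : Fin n => Sum.inl (Sum.inr i)).imp <|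
    (isTorsionSubgroup N' fun i : Fin m => Sum.inr i).imp <|
    (Formula.iAlls Unit <|
      (Formula.iInf fun i : Fin n => memRange
        (mulTerm (mulTerm (Term.var (Sum.inr ())) (Term.var (Sum.inl (Sum.inl (Sum.inr i)))))
          (invTerm (Term.var (Sum.inr ()))))
        fun j : Fin n => Sum.inl (Sum.inl (Sum.inr j))).imp <|
      (memRange (powTerm (Term.var (Sum.inr ())) 2)
        fun j : Fin n => Sum.inl (Sum.inl (Sum.inr j))).imp
      (memRange (Term.var (Sum.inr ())) fun j : Fin n => Sum.inl (Sum.inl (Sum.inr j)))).imp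
    (Formula.iExs Unit <| Formula.iInf fun i : Fin m => memRange
        (mulTerm (mulTerm (Term.var (Sum.inr ())) (Term.var (Sum.inl (Sum.inr i))))
          (invTerm (Term.var (Sum.inr ()))))
        fun j : Fin n => Sum.inl (Sum.inl (Sum.inr j)))

theorem realize_conjugacySentence (n m N N' : ℕ) :
    M ⊨ conjugacySentence n m N N' ↔ ∀ (x : Fin n → M) (y : Fin m → M),
      (∃ H : Subgroup M, (H : Set M) = Set.range x ∧ ∀ h ∈ H, h ^ N = 1) →
      (∃ K : Subgroup M, (K : Set M) = Set.range y ∧ ∀ k ∈ K, k ^ N' = 1) →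
      (∀ z : M, (∀ i, z * x i * z⁻¹ ∈ Set.range x) → z ^ 2 ∈ Set.range x → z ∈ Set.range x) →
      ∃ g : M, ∀ i, g * y i * g⁻¹ ∈ Set.range x := by
  rw [Sentence.Realize, conjugacySentence]
  simp only [Formula.realize_iAlls, Formula.realize_iExs, Formula.realize_imp,
    realize_isTorsionSubgroup, Formula.realize_iInf, realize_memRange, realize_mulTerm,
    realize_invTerm, realize_powTerm, Term.realize_var, Sum.elim_inl, Sum.elim_inr,
    Function.comp_def]
  refine forall₂_congr fun x y => imp_congr_right fun _ => imp_congr_right fun _ => imp_congr ?_ ?_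
  · exact ⟨fun h z => h fun _ => z, fun h z => h (z ())⟩
  · exact ⟨fun ⟨g, hg⟩ => ⟨g (), hg⟩, fun ⟨g, hg⟩ => ⟨fun _ => g, hg⟩⟩

end GroupFormula

/-! ### Finite subgroups of 2-groups -/

section TwoGroups

variable {G : Type*} [Group G]

/-- A proper subgroup of a finite 2-group has index two in some larger subgroup. -/
theorem IsPGroup.exists_sq_mem_of_lt {H S : Subgroup G} [Finite S] (hS : IsPGroup 2 S)
    (hlt : H < S) :
    ∃ z ∈ S, z ∉ H ∧ z ∈ Subgroup.normalizer (H : Set G) ∧ z ^ 2 ∈ H := by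
  have : Fact (Nat.Prime 2) := ⟨Nat.prime_two⟩
  have hle := hlt.le
  set H' := H.subgroupOf S with hH'
  obtain ⟨b, hb⟩ := IsPGroup.iff_card.mp (hS.to_subgroup H')
  obtain ⟨a, ha⟩ := IsPGroup.iff_card.mp hS
  have hba : b < a := by
    by_contra! hab
    have : H' = ⊤ := Subgroup.eq_top_of_le_card _ <| by
      rw [ha, hb]
      exact Nat.pow_le_pow_right two_pos hab
    exact hlt.not_ge (Subgroup.subgroupOf_eq_top.mp this)
  obtain ⟨K, hK, hHK⟩ := Sylow.exists_subgroup_card_pow_succ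
    (ha ▸ pow_dvd_pow 2 hba : 2 ^ (b + 1) ∣ Nat.card S) hb
  have hidx : (H'.subgroupOf K).index = 2 := by
    have h := (H'.subgroupOf K).card_mul_index
    rw [Nat.card_congr (Subgroup.subgroupOfEquivOfLe hHK).toEquiv, hb, hK, pow_succ] at h
    exact Nat.eq_of_mul_eq_mul_left (by positivity) h
  have hne : ∃ z ∈ K, z ∉ H' := by
    by_contra! h
    have : Nat.card K = Nat.card H' := by rw [le_antisymm h hHK]
    rw [hK, hb] at this
    exact absurd (Nat.pow_right_injective le_rfl this) (by simp)
  obtain ⟨z, hzK, hzH⟩ := hne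
  have hsq := Subgroup.mul_self_mem_of_index_two hidx ⟨z, hzK⟩
  have hnormal := Subgroup.normal_of_index_eq_two hidx
  refine ⟨z, z.2, fun h => hzH (Subgroup.mem_subgroupOf.mpr h), ?_, ?_⟩
  · have : Finite (H : Set G) := Finite.Set.subset (S : Set G) hle
    refine Subgroup.mem_normalizer_fintype fun h hh => ?_
    have hhH : (⟨h, hle hh⟩ : S) ∈ H' := Subgroup.mem_subgroupOf.mpr hh
    exact hnormal.conj_mem ⟨⟨h, hle hh⟩, hHK hhH⟩ hhH ⟨z, hzK⟩
  · rw [pow_two]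
    exact hsq

/-- Adjoining an element of finite order that normalizes a finite subgroup gives a finite
subgroup. -/
theorem Subgroup.finite_sup_zpowers {D : Subgroup G} [Finite D] {x : G}
    (hx : IsOfFinOrder x) (hxD : ∀ d ∈ D, x * d * x⁻¹ ∈ D) :
    Finite (D ⊔ Subgroup.zpowers x : Subgroup G) := by
  have hx' : x ∈ Subgroup.normalizer (D : Set G) :=
    have : Finite (D : Set G) := ‹Finite D›
    Subgroup.mem_normalizer_fintype hxD
  have h := Subgroup.coe_mul_of_right_le_normalizer_left D (Subgroup.zpowers x)
    (Subgroup.zpowers_le.mpr hx')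
  have hfin : ((D : Set G) * (Subgroup.zpowers x : Set G)).Finite :=
    (Set.toFinite (D : Set G)).mul hx.finite_zpowers
  exact (h ▸ hfin).to_subtype

/-- Two elements normalizing a finite subgroup `D` and squaring into `D` generate a finite subgroup
together with `D`, provided that their product has finite order. -/
theorem Subgroup.exists_finite_of_sq_mem {D : Subgroup G} [Finite D] {i j : G}
    (hi : IsOfFinOrder i) (hij : IsOfFinOrder (i * j))
    (hiD : i ∈ Subgroup.normalizer (D : Set G)) (hjD : j ∈ Subgroup.normalizer (D : Set G))
    (hi2 : i ^ 2 ∈ D) (hj2 : j ^ 2 ∈ D) :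
    ∃ E : Subgroup G, Finite E ∧ D ≤ E ∧ i ∈ E ∧ j ∈ E := by
  have hijD : i * j ∈ Subgroup.normalizer (D : Set G) := mul_mem hiD hjD
  set E := D ⊔ Subgroup.zpowers (i * j) with hE
  have : Finite E := Subgroup.finite_sup_zpowers hij fun d hd =>
    (Subgroup.mem_normalizer_iff.mp hijD d).mp hd
  have hDE : D ≤ E := le_sup_left
  have haE : i * j ∈ E := hE ▸ Subgroup.mem_sup_right (Subgroup.mem_zpowers _)
  -- Dihedral relation: conjugation by `i` inverts `i * j` modulo `D`, so it preserves `E`.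
  have hconj : E ≤ E.comap (MulAut.conj i).toMonoidHom := by
    refine sup_le (fun d hd => hDE ((Subgroup.mem_normalizer_iff.mp hiD d).mp hd)) ?_
    rw [Subgroup.zpowers_le]
    have : i * (i * j) * i⁻¹ = i ^ 2 * j ^ 2 * (i * j)⁻¹ := by simp [pow_two, mul_assoc]
    change i * (i * j) * i⁻¹ ∈ E
    rw [this]
    exact mul_mem (mul_mem (hDE hi2) (hDE hj2)) (inv_mem haE)
  have hiE : i ∈ E ⊔ Subgroup.zpowers i := Subgroup.mem_sup_right (Subgroup.mem_zpowers i)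
  refine ⟨E ⊔ Subgroup.zpowers i, Subgroup.finite_sup_zpowers hi fun d hd => hconj hd,
    hDE.trans le_sup_left, hiE, ?_⟩
  simpa using mul_mem (inv_mem hiE) (Subgroup.mem_sup_left (T := Subgroup.zpowers i) haE)

/-- A nonempty family on which a natural-valued function is bounded has a maximizer. -/
theorem Nat.exists_forall_le_of_bounded {α : Type*} {p : α → Prop} (f : α → ℕ) {N : ℕ}
    (hN : ∀ a, p a → f a ≤ N) (hp : ∃ a, p a) : ∃ a, p a ∧ ∀ b, p b → f b ≤ f a := by
  have hbdd : BddAbove (f '' {a | p a}) := ⟨N, by rintro _ ⟨a, ha, rfl⟩; exact hN a ha⟩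
  obtain ⟨a, ha, hfa⟩ := Nat.sSup_mem (Set.Nonempty.image f hp) hbdd
  exact ⟨a, ha, fun b hb => hfa ▸ le_csSup hbdd ⟨b, hb, rfl⟩⟩

/-- A 2-group whose finite subgroups have bounded order is finite. No chain condition on
centralizers is needed for this: two distinct maximal finite subgroups with largest intersection `D`
would both contain an involution modulo `D`, and in a 2-group two such involutions generate a finite
subgroup together with `D`. -/
theorem IsPGroup.finite_of_bounded_finite_subgroups (hG : IsPGroup 2 G) {N : ℕ}
    (hN : ∀ H : Subgroup G, Finite H → Nat.card H ≤ N) : Finite G := by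
  have hord : ∀ x : G, IsOfFinOrder x := fun x => by
    obtain ⟨k, hk⟩ := hG x
    exact isOfFinOrder_iff_pow_eq_one.mpr ⟨2 ^ k, by positivity, hk⟩
  have hmax : ∀ H : Subgroup G, Finite H →
      ∃ M, H ≤ M ∧ Maximal (fun K : Subgroup G => Finite K) M := fun H hH => by
    obtain ⟨M, ⟨hMf, hHM⟩, hM⟩ := Nat.exists_forall_le_of_bounded
      (p := fun K : Subgroup G => Finite K ∧ H ≤ K) (fun K => Nat.card K)
      (fun K hK => hN K hK.1) ⟨H, hH, le_rfl⟩
    exact ⟨M, hHM, hMf, fun K hK hMK =>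
      have := hK
      (Subgroup.eq_of_le_of_card_ge hMK (hM K ⟨hK, hHM.trans hMK⟩)).ge⟩
  have hlt : ∀ {D M : Subgroup G}, Finite M → D < M → Nat.card D < Nat.card M :=
    fun {D M} hM hDM => by
      by_contra! h
      exact hDM.ne (Subgroup.eq_of_le_of_card_ge hDM.le h)
  have huniq : ∀ M M' : Subgroup G, Maximal (fun K : Subgroup G => Finite K) M →
      Maximal (fun K : Subgroup G => Finite K) M' → M = M' := by
    by_contra! h
    obtain ⟨A, B, hA, hB, hAB⟩ := h
    obtain ⟨⟨M, M'⟩, ⟨hM, hM', hne⟩, hbest⟩ := Nat.exists_forall_le_of_bounded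
      (p := fun q : Subgroup G × Subgroup G => Maximal (fun K : Subgroup G => Finite K) q.1 ∧
        Maximal (fun K : Subgroup G => Finite K) q.2 ∧ q.1 ≠ q.2)
      (fun q => Nat.card (q.1 ⊓ q.2 : Subgroup G)) (N := N)
      (fun q hq => hN _ (have := hq.1.prop; Finite.Set.subset (q.1 : Set G) inf_le_left))
      ⟨(A, B), hA, hB, hAB⟩
    dsimp only at hM hM' hne hbest
    have := hM.prop
    have := hM'.prop
    set D := M ⊓ M' with hD
    have hDM : D < M := lt_of_le_of_ne inf_le_left fun h =>
      hne (hM.eq_of_le hM'.prop (inf_eq_left.mp h))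
    have hDM' : D < M' := lt_of_le_of_ne inf_le_right fun h =>
      hne (hM'.eq_of_le hM.prop (inf_eq_right.mp h)).symm
    have : Finite D := Finite.Set.subset (M : Set G) hDM.le
    obtain ⟨i, hiM, hiD, hin, hi2⟩ := (hG.to_subgroup M).exists_sq_mem_of_lt hDM
    obtain ⟨j, hjM, hjD, hjn, hj2⟩ := (hG.to_subgroup M').exists_sq_mem_of_lt hDM'
    obtain ⟨E, hEf, hDE, hiE, hjE⟩ :=
      Subgroup.exists_finite_of_sq_mem (hord i) (hord (i * j)) hin hjn hi2 hj2
    obtain ⟨L, hEL, hL⟩ := hmax E hEf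
    -- If `M₁ ≠ L`, then `M₁ ⊓ L` contains both `D` and `x ∉ D`, contradicting the choice of `D` as
    -- a largest intersection.
    have key : ∀ M₁ : Subgroup G, Maximal (fun K : Subgroup G => Finite K) M₁ → D ≤ M₁ →
        ∀ x ∈ M₁, x ∉ D → x ∈ L → M₁ = L := fun M₁ hM₁ hDM₁ x hx hxD hxL => by
      by_contra hML
      have := hM₁.prop
      refine (hbest (M₁, L) ⟨hM₁, hL, hML⟩).not_gt (hlt ?_ (lt_of_le_of_ne ?_ ?_))
      · exact Finite.Set.subset (M₁ : Set G) inf_le_left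
      · exact le_inf hDM₁ (hDE.trans hEL)
      · exact fun h => hxD (h ▸ ⟨hx, hxL⟩)
    exact hne ((key M hM hDM.le i hiM hiD (hEL hiE)).trans
      (key M' hM' hDM'.le j hjM hjD (hEL hjE)).symm)
  obtain ⟨M, -, hM⟩ := hmax ⊥ inferInstance
  -- Each cyclic subgroup is finite, so it lies in the unique maximal finite subgroup.
  have htop : M = ⊤ := by
    rw [eq_top_iff]
    intro x _
    obtain ⟨L, hxL, hL⟩ := hmax (Subgroup.zpowers x) (hord x).finite_zpowers.to_subtype
    exact huniq L M hL hM ▸ hxL (Subgroup.mem_zpowers x)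
  have : Finite (⊤ : Subgroup G) := htop ▸ hM.prop
  exact Finite.of_equiv _ Subgroup.topEquiv.toEquiv

/-- Such a `z` has 2-power order, so `P` and `z` generate a 2-group, which maximality makes equal to
`P`. This is the test in `conjugacySentence`. -/
theorem Sylow.mem_of_sq_mem (P : Sylow 2 G) {z : G}
    (hz : z ∈ Subgroup.normalizer (P : Set G)) (hz2 : z ^ 2 ∈ P) : z ∈ P := by
  have hzP : IsPGroup 2 (Subgroup.zpowers z) := by
    rintro ⟨_, n, rfl⟩
    obtain ⟨k, hk⟩ := P.isPGroup' ⟨_, hz2⟩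
    have hk' : (z ^ 2) ^ 2 ^ k = 1 := congrArg Subtype.val hk
    refine ⟨k + 1, Subtype.ext ?_⟩
    change (z ^ n) ^ 2 ^ (k + 1) = 1
    rw [← zpow_natCast, zpow_comm, zpow_natCast, pow_succ', pow_mul, hk', one_zpow]
  have h := P.is_maximal' (P.isPGroup'.to_sup_of_normal_left' hzP
    (Subgroup.zpowers_le.mpr hz)) le_sup_left
  have hzmem : z ∈ (P : Subgroup G) ⊔ Subgroup.zpowers z :=
    Subgroup.mem_sup_right (Subgroup.mem_zpowers z)
  rwa [h] at hzmem

/-! ### Transfer from finite groups -/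

/-- A finite group satisfies all the conjugacy sentences for 2-subgroups. -/
theorem conjugacySentence_mem_finiteGroupTheory (n m a b : ℕ) :
    GroupFormula.conjugacySentence n m (2 ^ a) (2 ^ b) ∈ finiteGroupTheory := by
  intro F _ _
  have : Fact (Nat.Prime 2) := ⟨Nat.prime_two⟩
  rw [GroupFormula.realize_conjugacySentence]
  rintro x y ⟨H, hHx, hH⟩ ⟨K, hKy, hK⟩ hN
  have hH' : IsPGroup 2 H := fun h => ⟨a, Subtype.ext (hH h h.2)⟩
  have hK' : IsPGroup 2 K := fun k => ⟨b, Subtype.ext (hK k k.2)⟩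
  obtain ⟨P, hHP⟩ := hH'.exists_le_sylow
  obtain ⟨Q, hKQ⟩ := hK'.exists_le_sylow
  -- Were `H` proper in `P`, an element of `P` squaring into `H` and normalizing it would violate
  -- `hN`.
  have hPH : H = P := by
    by_contra hne
    obtain ⟨z, -, hzH, hzn, hz2⟩ := P.isPGroup'.exists_sq_mem_of_lt (lt_of_le_of_ne hHP hne)
    refine hzH ?_
    rw [← SetLike.mem_coe, hHx]
    refine hN z (fun i => ?_) (hHx ▸ hz2)
    rw [← hHx]
    exact (Subgroup.mem_normalizer_iff.mp hzn _).mp (SetLike.mem_coe.mp (hHx ▸ ⟨i, rfl⟩))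
  obtain ⟨g, hg⟩ := MulAction.exists_smul_eq F Q P
  refine ⟨g, fun i => ?_⟩
  rw [← hHx, hPH, ← hg]
  have hy : y i ∈ Q := hKQ (SetLike.mem_coe.mp (hKy ▸ ⟨i, rfl⟩))
  exact Subgroup.smul_mem_pointwise_smul (y i) (MulAut.conj g) (Q : Subgroup F) hy

/-- In a model of the theory of finite groups, all finite 2-subgroups are conjugate into any given
finite Sylow 2-subgroup. -/
theorem Sylow.exists_conj_mem_of_model (hG : G ⊨ finiteGroupTheory) (P : Sylow 2 G) [Finite P]
    (K : Subgroup G) [Finite K] (hK : IsPGroup 2 K) :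
    ∃ g : G, ∀ k ∈ K, g * k * g⁻¹ ∈ P := by
  have : Fact (Nat.Prime 2) := ⟨Nat.prime_two⟩
  obtain ⟨a, ha⟩ := IsPGroup.iff_card.mp P.isPGroup'
  obtain ⟨b, hb⟩ := IsPGroup.iff_card.mp hK
  -- By Lagrange, the orders `2 ^ a` and `2 ^ b` serve as the exponents `N` and `N'`.
  have h := (GroupFormula.realize_conjugacySentence (M := G) _ _ _ _).mp
    (hG.realize_of_mem _ (conjugacySentence_mem_finiteGroupTheory (Nat.card P) (Nat.card K) a b))
  let eP := Finite.equivFin P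
  let eK := Finite.equivFin K
  have hP : Set.range (fun i => (eP.symm i : G)) = (P : Set G) :=
    (eP.symm.surjective.range_comp Subtype.val).trans Subtype.range_coe
  have hKr : Set.range (fun i => (eK.symm i : G)) = (K : Set G) :=
    (eK.symm.surjective.range_comp Subtype.val).trans Subtype.range_coe
  obtain ⟨g, hg⟩ := h (fun i => (eP.symm i : G)) (fun i => (eK.symm i : G))
    ⟨P, hP.symm, fun p hp => ha ▸ congrArg Subtype.val (pow_card_eq_one' (x := (⟨p, hp⟩ : P)))⟩
    ⟨K, hKr.symm, fun k hk => hb ▸ congrArg Subtype.val (pow_card_eq_one' (x := (⟨k, hk⟩ : K)))⟩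
    fun z hz hz2 => by
      rw [hP] at hz hz2 ⊢
      have : Finite (P : Set G) := ‹Finite P›
      refine P.mem_of_sq_mem (Subgroup.mem_normalizer_fintype fun p hp => ?_) hz2
      simpa using hz (eP ⟨p, hp⟩)
  refine ⟨g, fun k hk => ?_⟩
  have := hg (eK ⟨k, hk⟩)
  rw [hP] at this
  simpa using this

/-- In a model of the theory of finite groups with a finite Sylow 2-subgroup, all Sylow 2-subgroups
are finite. -/
theorem Sylow.finite_of_model (hG : G ⊨ finiteGroupTheory) (P : Sylow 2 G) [Finite P]
    (Q : Sylow 2 G) : Finite Q := by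
  refine Q.isPGroup'.finite_of_bounded_finite_subgroups (N := Nat.card P) fun H hH => ?_
  have : Finite (H.map (Q : Subgroup G).subtype) :=
    (Set.toFinite ((Q : Subgroup G).subtype '' (H : Set Q))).to_subtype
  obtain ⟨g, hg⟩ := P.exists_conj_mem_of_model hG (H.map (Q : Subgroup G).subtype)
    ((Q.isPGroup'.to_subgroup H).map _)
  refine Nat.card_le_card_of_injective
    (fun h : H => (⟨g * (h : Q) * g⁻¹, hg _ ⟨h, h.2, rfl⟩⟩ : P)) fun h h' hh => ?_
  simpa using congrArg Subtype.val hh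

/-- A conjugate of `Q` lies in `P`; being itself a maximal 2-subgroup, it equals `P`. -/
theorem Sylow.eq_map_conj_of_model (hG : G ⊨ finiteGroupTheory) (P : Sylow 2 G) [Finite P]
    (Q : Sylow 2 G) [Finite Q] :
    ∃ g : G, (P : Subgroup G) = (Q : Subgroup G).map (MulAut.conj g).toMonoidHom := by
  obtain ⟨g, hg⟩ := P.exists_conj_mem_of_model hG Q Q.isPGroup'
  refine ⟨g, (g • Q).is_maximal' P.isPGroup' ?_⟩
  rintro _ ⟨q, hq, rfl⟩
  exact hg q hq

end TwoGroups

theorem theorem3p3 {G : Type*} [Group G] (hG : IsPseudofiniteGroup G) (hMc : IsMcGroup G)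
    (P : Sylow 2 G) (hP : Finite P) :
    (∀ Q R : Sylow 2 G, ∃ g : G,
      (R : Subgroup G) = (Q : Subgroup G).map (MulAut.conj g).toMonoidHom) ∧
    (∀ Q : Sylow 2 G, Finite Q) := by
  have hfin : ∀ Q : Sylow 2 G, Finite Q := P.finite_of_model hG.2
  refine ⟨fun Q R => ?_, hfin⟩
  have := hfin Q
  have := hfin R
  exact R.eq_map_conj_of_model hG.2 Q
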